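/- For a metric space $(M,d)$, the center of distances of $M$ is the set $S(M)=\{\alpha\in\mathbb R : \forall x\in M\ \exists y\in M\ \ d(x,y)=\alpha\}$. Let $$\mathbb X=\Big\{\sum_{n=1}^{\infty}\frac{x_n}{4^n} : x_n\in\{0,2,3,5\}\text{ for all } n\ge 1\Big\}\subset\mathbb R,$$ and let $\mathbb Y=\mathbb X\setminus\operatorname{int}\mathbb X$, where the interior is taken in $\mathbb R$ and $\mathbb Y$ carries the metric $d(x,y)=|x-y|$. Then $$S(\mathbb Y)=\{0\}\cup\Big\{\frac1{4^n} : n=0,1,2,\ldots\Big\}.$$ -/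

import Mathlib

/-- The center of distances of a metric space `X`: the set of reals `α` such that every point of
`X` has some point of `X` at distance exactly `α`. -/
def centerOfDistances (X : Type*) [MetricSpace X] : Set ℝ :=
  {α : ℝ | ∀ x : X, ∃ y : X, dist x y = α}

/-- The Cantorval: all reals `∑_{n > 0} xₙ / 4ⁿ` with digits `xₙ ∈ {0, 2, 3, 5}`. The sequence is
indexed from `0` here, so that the digit `d n` has weight `1 / 4 ^ (n + 1)`. -/
def cantorval : Set ℝ :=
  {x : ℝ | ∃ d : ℕ → ℝ, (∀ n, d n ∈ ({0, 2, 3, 5} : Set ℝ)) ∧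
    HasSum (fun n => d n / 4 ^ (n + 1)) x}

/-- The boundary part of the Cantorval: the Cantorval minus its interior in `ℝ`. -/
def cantorvalBoundary : Set ℝ := cantorval \ interior cantorval

open Set Filter Topology

/-! ### The Cantorval -/

/-! The digit set is symmetric under `a ↦ 5 - a`, and `[2/3, 1]` lies in the Cantorval. Hence its
boundary is `L ∪ (1 + L)` with `L = leftBoundary`, and `L` is the self-similar set `⋃ (a + L) / 4`
over digits `a ∈ {0, 1, 2}` (`add_div_four_mem_leftBoundary`, `exists_digit_of_mem_leftBoundary`).
Distance `1` swaps the two copies of `L`; distance `1 / 4 ^ (n + 1)` changes a single digit by one.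
Conversely, the point `0` forces a candidate `α` into the boundary. If `α > 1`, the point `1` rules
it out. If `α ∈ L` is positive and not a power of `1 / 4`, a short-digit witness, scaled to the
leading digit of `α`, has both translates by `α` outside the boundary. -/

theorem summable_cantorval_digits {d : ℕ → ℝ} (hd : ∀ n, d n ∈ ({0, 2, 3, 5} : Set ℝ)) :
    Summable fun n => d n / 4 ^ (n + 1) := by
  have hb : ∀ n, 0 ≤ d n ∧ d n ≤ 5 := fun n => by
    rcases hd n with h | h | h | h <;> rw [h] <;> norm_num
  refine Summable.of_nonneg_of_le (f := fun n => 5 / 4 * (1 / 4 : ℝ) ^ n)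
    (fun n => div_nonneg (hb n).1 (by positivity)) (fun n => ?_)
    ((summable_geometric_of_lt_one (by norm_num) (by norm_num)).mul_left _)
  calc d n / 4 ^ (n + 1) ≤ 5 / 4 ^ (n + 1) := by gcongr; exact (hb n).2
    _ = 5 / 4 * (1 / 4 : ℝ) ^ n := by rw [pow_succ, one_div_pow]; field_simp

theorem hasSum_five_div_four_pow : HasSum (fun n : ℕ => (5 : ℝ) / 4 ^ (n + 1)) (5 / 3) := by
  have h := (hasSum_geometric_of_lt_one (r := (1 / 4 : ℝ)) (by norm_num) (by norm_num)).mul_left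
    (5 / 4)
  rw [show (5 / 4 * (1 - 1 / 4)⁻¹ : ℝ) = 5 / 3 by norm_num] at h
  refine h.congr_fun fun n => ?_
  rw [pow_succ, one_div_pow]; field_simp

theorem zero_mem_cantorval : (0 : ℝ) ∈ cantorval :=
  ⟨fun _ => 0, by simp, by simp [hasSum_zero]⟩

theorem cantorval_nonneg {x : ℝ} (hx : x ∈ cantorval) : 0 ≤ x := by
  obtain ⟨d, hd, h⟩ := hx
  refine h.nonneg fun n => div_nonneg ?_ (by positivity)
  rcases hd n with h | h | h | h <;> rw [h] <;> norm_num

theorem five_thirds_sub_mem_cantorval {x : ℝ} (hx : x ∈ cantorval) : 5 / 3 - x ∈ cantorval := by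
  obtain ⟨d, hd, h⟩ := hx
  refine ⟨fun n => 5 - d n, fun n => ?_, ?_⟩
  · rcases hd n with h | h | h | h <;> (beta_reduce; rw [h]; norm_num)
  · simpa only [sub_div] using hasSum_five_div_four_pow.sub h

theorem cantorval_le {x : ℝ} (hx : x ∈ cantorval) : x ≤ 5 / 3 :=
  sub_nonneg.1 (cantorval_nonneg (five_thirds_sub_mem_cantorval hx))

theorem add_div_four_mem_cantorval {x a : ℝ} (hx : x ∈ cantorval)
    (ha : a ∈ ({0, 2, 3, 5} : Set ℝ)) : (a + x) / 4 ∈ cantorval := by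
  obtain ⟨d, hd, h⟩ := hx
  refine ⟨fun n => n.casesOn a d, fun n => by cases n; exacts [ha, hd _], ?_⟩
  rw [← hasSum_nat_add_iff' 1]
  have hsum : (a + x) / 4 - ∑ i ∈ Finset.range 1, (Nat.casesOn i a d : ℝ) / 4 ^ (i + 1) = x / 4 := by
    rw [Finset.sum_range_one]
    change (a + x) / 4 - a / 4 ^ (0 + 1) = x / 4
    ring
  rw [hsum]
  refine (h.div_const 4).congr_fun fun n => ?_
  rw [pow_succ _ (n + 1), div_mul_eq_div_div]

theorem exists_digit_of_mem_cantorval {x : ℝ} (hx : x ∈ cantorval) :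
    ∃ a ∈ ({0, 2, 3, 5} : Set ℝ), ∃ y ∈ cantorval, x = (a + y) / 4 := by
  obtain ⟨d, hd, h⟩ := hx
  refine ⟨d 0, hd 0, 4 * x - d 0, ⟨fun n => d (n + 1), fun n => hd _, ?_⟩, by ring⟩
  rw [← hasSum_nat_add_iff' 1] at h
  have hsum : 4 * x - d 0 = 4 * (x - ∑ i ∈ Finset.range 1, d i / 4 ^ (i + 1)) := by
    rw [Finset.sum_range_one]; ring
  rw [hsum]
  refine (h.mul_left 4).congr_fun fun n => ?_
  rw [pow_succ _ (n + 1)]; field_simp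

theorem isClosed_cantorval : IsClosed cantorval := by
  have hc : IsCompact (univ.pi fun _ : ℕ => ({0, 2, 3, 5} : Set ℝ)) :=
    isCompact_univ_pi fun _ => (Set.toFinite _).isCompact
  have himg : cantorval =
      (fun d : ℕ → ℝ => ∑' n, d n / 4 ^ (n + 1)) '' univ.pi fun _ : ℕ => ({0, 2, 3, 5} : Set ℝ) := by
    ext x
    constructor
    · rintro ⟨d, hd, h⟩
      exact ⟨d, fun n _ => hd n, h.tsum_eq⟩
    · rintro ⟨d, hd, rfl⟩
      have hd' : ∀ n, d n ∈ ({0, 2, 3, 5} : Set ℝ) := fun n => hd n (mem_univ n)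
      exact ⟨d, hd', (summable_cantorval_digits hd').hasSum⟩
  rw [himg]
  refine (hc.image_of_continuousOn ?_).isClosed
  refine continuousOn_tsum (u := fun n => (5 : ℝ) / 4 ^ (n + 1)) (fun n => by fun_prop)
    hasSum_five_div_four_pow.summable fun n d hd => ?_
  rw [norm_div, norm_pow, Real.norm_ofNat]
  gcongr
  rcases hd n (mem_univ n) with h | h | h | h <;> rw [h] <;> norm_num

/-- The `n`-digit numerators over `{0, 2, 3, 5}` in base four fill the integer interval from
`2 * (4 ^ n - 1) / 3` to `4 ^ n - 1`. -/
theorem int_add_div_four_pow_mem_cantorval (n : ℕ) :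
    ∀ m : ℤ, 2 * (4 ^ n - 1) ≤ 3 * m → m ≤ 4 ^ n - 1 → ∀ y ∈ cantorval,
      (m + y) / 4 ^ n ∈ cantorval := by
  induction n with
  | zero =>
    intro m h₁ h₂ y hy
    obtain rfl : m = 0 := by simp at h₁ h₂; omega
    simpa using hy
  | succ n ih =>
    intro m h₁ h₂ y hy
    -- The lower endpoint `2 * (4 ^ n - 1) / 3` is thus an integer, which the bounds on `m'` below
    -- need.
    obtain ⟨q, hq⟩ : (3 : ℤ) ∣ 4 ^ n - 1 := by
      simpa using sub_dvd_pow_sub_pow (4 : ℤ) 1 n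
    rw [pow_succ] at h₁ h₂
    obtain ⟨m', a, ha, hm, h₁', h₂'⟩ : ∃ m' a : ℤ, (a = 0 ∨ a = 2 ∨ a = 3 ∨ a = 5) ∧
        m = 4 * m' + a ∧ 2 * (4 ^ n - 1) ≤ 3 * m' ∧ m' ≤ 4 ^ n - 1 := by
      generalize (4 : ℤ) ^ n = N at *
      -- `{0, 2, 3, 5}` is a complete residue system mod 4, with 5 standing for residue 1.
      have : m % 4 = 0 ∨ m % 4 = 1 ∨ m % 4 = 2 ∨ m % 4 = 3 := by omega
      rcases this with h | h | h | h
      · exact ⟨m / 4, 0, by omega, by omega, by omega, by omega⟩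
      · exact ⟨(m - 5) / 4, 5, by omega, by omega, by omega, by omega⟩
      · exact ⟨(m - 2) / 4, 2, by omega, by omega, by omega, by omega⟩
      · exact ⟨(m - 3) / 4, 3, by omega, by omega, by omega, by omega⟩
    have ha' : (a : ℝ) ∈ ({0, 2, 3, 5} : Set ℝ) := by
      rcases ha with rfl | rfl | rfl | rfl <;> simp
    convert ih m' h₁' h₂' _ (add_div_four_mem_cantorval hy ha') using 1
    rw [hm, pow_succ]
    push_cast
    field_simp
    ring

theorem mem_of_isClosed_of_approx {s : Set ℝ} (hs : IsClosed s) {x : ℝ}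
    (h : ∀ n : ℕ, ∃ y ∈ s, |x - y| ≤ 1 / 4 ^ n) : x ∈ s := by
  rw [← hs.closure_eq, Metric.mem_closure_iff]
  intro ε hε
  obtain ⟨n, hn⟩ := exists_pow_lt_of_lt_one hε (show (1 / 4 : ℝ) < 1 by norm_num)
  obtain ⟨y, hy, hxy⟩ := h n
  refine ⟨y, hy, ?_⟩
  rw [Real.dist_eq]
  rw [one_div_pow] at hn
  linarith

theorem Icc_subset_cantorval : Icc (2 / 3 : ℝ) 1 ⊆ cantorval := by
  -- At `x = 1` the floor would be `4 ^ n`, one too large; closedness restores that endpoint.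
  have hIco : Ico (2 / 3 : ℝ) 1 ⊆ cantorval := by
    rintro x ⟨h₁, h₂⟩
    refine mem_of_isClosed_of_approx isClosed_cantorval fun n => ?_
    have h4 : (0 : ℝ) < 4 ^ n := by positivity
    have hf₁ := Int.floor_le ((4 : ℝ) ^ n * x)
    have hf₂ := Int.lt_floor_add_one ((4 : ℝ) ^ n * x)
    refine ⟨_, int_add_div_four_pow_mem_cantorval n ⌊(4 : ℝ) ^ n * x⌋ ?_ ?_ 0 zero_mem_cantorval,
      ?_⟩
    · have : (2 * 4 ^ n - 3 : ℝ) < 3 * (⌊(4 : ℝ) ^ n * x⌋ : ℝ) := by nlinarith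
      have : (2 * 4 ^ n - 3 : ℤ) < 3 * ⌊(4 : ℝ) ^ n * x⌋ := by exact_mod_cast this
      omega
    · have : (⌊(4 : ℝ) ^ n * x⌋ : ℝ) < 4 ^ n := by nlinarith
      have : ⌊(4 : ℝ) ^ n * x⌋ < 4 ^ n := by exact_mod_cast this
      omega
    · rw [add_zero, show x = 4 ^ n * x / 4 ^ n by field_simp, ← sub_div, abs_div, abs_of_pos h4,
        mul_div_cancel_left₀ _ h4.ne']
      gcongr
      rw [abs_le]
      constructor <;> linarith
  rw [← closure_Ico (by norm_num : (2 / 3 : ℝ) ≠ 1)]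
  exact closure_minimal hIco isClosed_cantorval

/-! ### Self-similarity of the boundary -/

theorem isClosed_cantorvalBoundary : IsClosed cantorvalBoundary :=
  isClosed_cantorval.sdiff isOpen_interior

theorem mem_cantorvalBoundary_iff {x : ℝ} :
    x ∈ cantorvalBoundary ↔ x ∈ cantorval ∧ cantorval ∉ 𝓝 x := by
  rw [cantorvalBoundary, Set.mem_sdiff, mem_interior_iff_mem_nhds]

theorem cantorvalBoundary_nonneg {x : ℝ} (hx : x ∈ cantorvalBoundary) : 0 ≤ x :=
  cantorval_nonneg hx.1

theorem cantorvalBoundary_le {x : ℝ} (hx : x ∈ cantorvalBoundary) : x ≤ 5 / 3 :=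
  cantorval_le hx.1

/-- An affine bijection preserving the Cantorval locally also preserves its boundary locally. -/
theorem mem_cantorvalBoundary_iff_affine {a b : ℝ} (ha : a ≠ 0) {U : Set ℝ} (hU : IsOpen U)
    (h : ∀ z ∈ U, z ∈ cantorval ↔ a * z + b ∈ cantorval) {x : ℝ} (hx : x ∈ U) :
    x ∈ cantorvalBoundary ↔ a * x + b ∈ cantorvalBoundary := by
  have hmap : map (fun z => a * z + b) (𝓝 x) = 𝓝 (a * x + b) :=
    (affineHomeomorph a b ha).map_nhds_eq x
  have hnhds : cantorval ∈ 𝓝 x ↔ cantorval ∈ 𝓝 (a * x + b) := by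
    rw [← hmap, mem_map]
    refine eventually_congr (p := (· ∈ cantorval)) ?_
    filter_upwards [hU.mem_nhds hx] with z hz using h z hz
  rw [mem_cantorvalBoundary_iff, mem_cantorvalBoundary_iff, hnhds, h x hx]

theorem five_thirds_sub_mem_cantorvalBoundary {x : ℝ} (hx : x ∈ cantorvalBoundary) :
    5 / 3 - x ∈ cantorvalBoundary := by
  have h := (mem_cantorvalBoundary_iff_affine (a := -1) (b := 5 / 3) (by norm_num) isOpen_univ
    (fun z _ => ⟨fun hz => ?_, fun hz => ?_⟩) (mem_univ x)).1 hx
  · convert h using 1; ring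
  · convert five_thirds_sub_mem_cantorval hz using 1; ring
  · convert five_thirds_sub_mem_cantorval hz using 1; ring

/-- Below `1/2` the first digit must be 0, as the others contribute at least `2/4`. -/
theorem mem_cantorvalBoundary_iff_four_mul {x : ℝ} (hx : x < 1 / 2) :
    x ∈ cantorvalBoundary ↔ 4 * x ∈ cantorvalBoundary := by
  have h := mem_cantorvalBoundary_iff_affine (a := 4) (b := 0) (by norm_num)
    (isOpen_Iio (a := (1 / 2 : ℝ))) (fun z hz => ⟨fun h => ?_, fun h => ?_⟩) hx
  · simpa using h
  · obtain ⟨a, ha, y, hy, rfl⟩ := exists_digit_of_mem_cantorval h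
    have := cantorval_nonneg hy
    rw [mem_Iio] at hz
    rcases ha with rfl | rfl | rfl | rfl
    · convert hy using 1; ring
    all_goals linarith
  · convert add_div_four_mem_cantorval h (a := 0) (by simp) using 1; ring

/-- Only first digit 2 is possible here: digit 0 gives at most `5/12`, digits 3 and 5 at least
`3/4`. -/
theorem mem_cantorvalBoundary_iff_four_mul_sub_two {x : ℝ} (hx : x ∈ Ioo (5 / 12 : ℝ) (3 / 4)) :
    x ∈ cantorvalBoundary ↔ 4 * x - 2 ∈ cantorvalBoundary := by
  have h := mem_cantorvalBoundary_iff_affine (a := 4) (b := -2) (by norm_num)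
    (isOpen_Ioo (a := (5 / 12 : ℝ)) (b := 3 / 4)) (fun z hz => ⟨fun h => ?_, fun h => ?_⟩) hx
  · simpa [sub_eq_add_neg] using h
  · obtain ⟨a, ha, y, hy, rfl⟩ := exists_digit_of_mem_cantorval h
    have h₁ := cantorval_nonneg hy
    have h₂ := cantorval_le hy
    obtain ⟨h₃, h₄⟩ := hz
    rcases ha with rfl | rfl | rfl | rfl
    · linarith
    · convert hy using 1; ring
    all_goals linarith
  · convert add_div_four_mem_cantorval h (a := 2) (by simp) using 1; ring

theorem zero_mem_cantorvalBoundary : (0 : ℝ) ∈ cantorvalBoundary := by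
  refine mem_cantorvalBoundary_iff.2 ⟨zero_mem_cantorval, fun h => ?_⟩
  obtain ⟨ε, hε, hball⟩ := Metric.mem_nhds_iff.1 h
  have hmem : -(ε / 2) ∈ Metric.ball (0 : ℝ) ε := by
    rw [mem_ball_zero_iff, Real.norm_eq_abs, abs_neg, abs_of_pos (by linarith)]
    linarith
  have := cantorval_nonneg (hball hmem)
  linarith

theorem notMem_cantorvalBoundary_of_mem_Ioo {x : ℝ} (hx : x ∈ Ioo (2 / 3 : ℝ) 1) :
    x ∉ cantorvalBoundary := fun h =>
  (mem_cantorvalBoundary_iff.1 h).2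
    (mem_of_superset (Icc_mem_nhds hx.1 hx.2) Icc_subset_cantorval)

/-- The part of the boundary of the Cantorval left of its central interval `[2 / 3, 1]`. -/
def leftBoundary : Set ℝ := cantorvalBoundary ∩ Icc 0 (2 / 3)

theorem isClosed_leftBoundary : IsClosed leftBoundary :=
  isClosed_cantorvalBoundary.inter isClosed_Icc

theorem zero_mem_leftBoundary : (0 : ℝ) ∈ leftBoundary :=
  ⟨zero_mem_cantorvalBoundary, by norm_num, by norm_num⟩

theorem leftBoundary_dichotomy {x : ℝ} (hx : x ∈ cantorvalBoundary) :
    x ∈ leftBoundary ∨ 5 / 3 - x ∈ leftBoundary := by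
  have h₁ := cantorvalBoundary_nonneg hx
  have h₂ := cantorvalBoundary_le hx
  rcases le_or_gt x (2 / 3) with h | h
  · exact Or.inl ⟨hx, h₁, h⟩
  · have : 1 ≤ x := not_lt.1 fun h' => notMem_cantorvalBoundary_of_mem_Ioo ⟨h, h'⟩ hx
    exact Or.inr ⟨five_thirds_sub_mem_cantorvalBoundary hx, by linarith, by linarith⟩

theorem div_four_mem_leftBoundary {y : ℝ} (hy : y ∈ leftBoundary) : y / 4 ∈ leftBoundary := by
  obtain ⟨h, h₁, h₂⟩ := hy
  refine ⟨(mem_cantorvalBoundary_iff_four_mul (by linarith)).2 ?_, by linarith, by linarith⟩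
  convert h using 1; ring

theorem five_twelfths_sub_mem_leftBoundary {y : ℝ} (hy : y ∈ leftBoundary) :
    5 / 12 - y / 4 ∈ leftBoundary := by
  obtain ⟨h, h₁, h₂⟩ := hy
  refine ⟨(mem_cantorvalBoundary_iff_four_mul (by linarith)).2 ?_, by linarith, by linarith⟩
  convert five_thirds_sub_mem_cantorvalBoundary h using 1; ring

theorem half_add_mem_leftBoundary {y : ℝ} (hy : y ∈ leftBoundary) :
    1 / 2 + y / 4 ∈ leftBoundary := by
  obtain ⟨h, h₁, h₂⟩ := hy
  refine ⟨(mem_cantorvalBoundary_iff_four_mul_sub_two ⟨by linarith, by linarith⟩).2 ?_,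
    by linarith, by linarith⟩
  convert h using 1; ring

theorem leftBoundary_cases {x : ℝ} (hx : x ∈ leftBoundary) :
    ∃ y ∈ leftBoundary, x = y / 4 ∨ x = 5 / 12 - y / 4 ∨ x = 1 / 2 + y / 4 := by
  obtain ⟨h, h₁, h₂⟩ := hx
  rcases lt_or_ge x (1 / 2) with hlt | hge
  · rcases leftBoundary_dichotomy ((mem_cantorvalBoundary_iff_four_mul hlt).1 h) with h' | h'
    · exact ⟨_, h', Or.inl (by ring)⟩
    · exact ⟨_, h', Or.inr (Or.inl (by ring))⟩
  · exact ⟨4 * x - 2,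
      ⟨(mem_cantorvalBoundary_iff_four_mul_sub_two ⟨by linarith, by linarith⟩).1 h,
        by linarith, by linarith⟩, Or.inr (Or.inr (by ring))⟩

/-- The reflection exchanges the two outer pieces of `leftBoundary_cases` and preserves the middle
one, so each level divides the approximation error by 4. It turns the orientation-reversing middle
map into `y ↦ (1 + y) / 4`. -/
theorem two_thirds_sub_mem_leftBoundary {x : ℝ} (hx : x ∈ leftBoundary) :
    2 / 3 - x ∈ leftBoundary := by
  have key : ∀ n : ℕ, ∀ x ∈ leftBoundary, ∃ y ∈ leftBoundary, |2 / 3 - x - y| ≤ 1 / 4 ^ n := by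
    intro n
    induction n with
    | zero =>
      intro x ⟨_, h₁, h₂⟩
      refine ⟨0, zero_mem_leftBoundary, ?_⟩
      rw [abs_le]
      constructor <;> norm_num <;> linarith
    | succ n ih =>
      intro x hx
      obtain ⟨x', hx', h⟩ := leftBoundary_cases hx
      obtain ⟨y, hy, hxy⟩ := ih x' hx'
      have hpow : (1 : ℝ) / 4 ^ (n + 1) = 1 / 4 ^ n / 4 := by rw [pow_succ]; field_simp
      rw [hpow]
      rw [abs_le] at hxy
      rcases h with rfl | rfl | rfl
      · refine ⟨_, half_add_mem_leftBoundary hy, ?_⟩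
        rw [abs_le]; constructor <;> linarith
      · refine ⟨_, five_twelfths_sub_mem_leftBoundary hy, ?_⟩
        rw [abs_le]; constructor <;> linarith
      · refine ⟨_, div_four_mem_leftBoundary hy, ?_⟩
        rw [abs_le]; constructor <;> linarith
  exact mem_of_isClosed_of_approx isClosed_leftBoundary fun n => key n x hx

/-- The left part of the boundary consists of the sums of `a n / 4 ^ (n + 1)` with digits
`a n ∈ {0, 1, 2}`; here is the corresponding self-similarity. -/
theorem add_div_four_mem_leftBoundary {y a : ℝ} (hy : y ∈ leftBoundary)
    (ha : a = 0 ∨ a = 1 ∨ a = 2) : (a + y) / 4 ∈ leftBoundary := by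
  rcases ha with rfl | rfl | rfl
  · convert div_four_mem_leftBoundary hy using 1; ring
  · convert five_twelfths_sub_mem_leftBoundary (two_thirds_sub_mem_leftBoundary hy) using 1; ring
  · convert half_add_mem_leftBoundary hy using 1; ring

theorem exists_digit_of_mem_leftBoundary {x : ℝ} (hx : x ∈ leftBoundary) :
    ∃ a : ℝ, (a = 0 ∨ a = 1 ∨ a = 2) ∧ ∃ y ∈ leftBoundary, x = (a + y) / 4 := by
  obtain ⟨y, hy, rfl | rfl | rfl⟩ := leftBoundary_cases hx
  · exact ⟨0, by simp, y, hy, by ring⟩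
  · exact ⟨1, by simp, 2 / 3 - y, two_thirds_sub_mem_leftBoundary hy, by ring⟩
  · exact ⟨2, by simp, y, hy, by ring⟩

theorem mem_cantorvalBoundary_cases {x : ℝ} (hx : x ∈ cantorvalBoundary) :
    x ∈ leftBoundary ∨ x - 1 ∈ leftBoundary := by
  refine (leftBoundary_dichotomy hx).imp_right fun h => ?_
  convert two_thirds_sub_mem_leftBoundary h using 1; ring

theorem add_one_mem_cantorvalBoundary {x : ℝ} (hx : x ∈ leftBoundary) :
    x + 1 ∈ cantorvalBoundary := by
  convert five_thirds_sub_mem_cantorvalBoundary (two_thirds_sub_mem_leftBoundary hx).1 using 1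
  ring

theorem div_four_pow_mem_leftBoundary {x : ℝ} (hx : x ∈ leftBoundary) (k : ℕ) :
    x / 4 ^ k ∈ leftBoundary := by
  induction k with
  | zero => simpa using hx
  | succ k ih =>
    convert div_four_mem_leftBoundary ih using 1
    rw [pow_succ]; field_simp

theorem div_four_pow_notMem_cantorvalBoundary {z : ℝ} (hz : z ∈ Ioo (2 / 3 : ℝ) 1) (k : ℕ) :
    z / 4 ^ k ∉ cantorvalBoundary := by
  induction k with
  | zero => simpa using notMem_cantorvalBoundary_of_mem_Ioo hz
  | succ k ih =>
    intro h
    have hle : z / 4 ^ (k + 1) < 1 / 2 := by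
      rw [div_lt_iff₀ (by positivity), pow_succ]
      have := one_le_pow₀ (n := k) (show (1 : ℝ) ≤ 4 by norm_num)
      linarith [hz.2]
    refine ih ?_
    convert (mem_cantorvalBoundary_iff_four_mul hle).1 h using 1
    rw [pow_succ]; field_simp

theorem div_four_pow_notMem_cantorvalBoundary_of_neg {z : ℝ} (hz : z < 0) (k : ℕ) :
    z / 4 ^ k ∉ cantorvalBoundary := fun h =>
  absurd (cantorvalBoundary_nonneg h) (not_le.2 (div_neg_of_neg_of_pos hz (by positivity)))

/-! ### The center of distances -/

theorem mem_centerOfDistances_cantorvalBoundary_iff {α : ℝ} (hα : 0 ≤ α) :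
    α ∈ centerOfDistances (cantorvalBoundary : Set ℝ) ↔
      ∀ x ∈ cantorvalBoundary, x + α ∈ cantorvalBoundary ∨ x - α ∈ cantorvalBoundary := by
  simp only [centerOfDistances, mem_ofPred_eq, Subtype.forall, Subtype.exists, Subtype.dist_eq,
    Real.dist_eq, exists_prop]
  refine forall₂_congr fun x _ => ⟨?_, ?_⟩
  · rintro ⟨y, hy, h⟩
    rcases (abs_eq hα).1 h with h | h
    · exact Or.inr (by convert hy using 1; linarith)
    · exact Or.inl (by convert hy using 1; linarith)
  · rintro (h | h)
    · exact ⟨_, h, by rw [sub_add_cancel_left, abs_neg, abs_of_nonneg hα]⟩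
    · exact ⟨_, h, by rw [sub_sub_cancel, abs_of_nonneg hα]⟩

/-- The digits 0, 1, 2 are consecutive, so each has a neighbour: one digit moves by `±1` and the
rest stay fixed. -/
theorem add_or_sub_mem_leftBoundary (n : ℕ) : ∀ x ∈ leftBoundary,
    x + 1 / 4 ^ (n + 1) ∈ leftBoundary ∨ x - 1 / 4 ^ (n + 1) ∈ leftBoundary := by
  induction n with
  | zero =>
    intro x hx
    obtain ⟨a, ha, y, hy, rfl⟩ := exists_digit_of_mem_leftBoundary hx
    rcases ha with rfl | rfl | rfl
    · left
      convert add_div_four_mem_leftBoundary hy (a := 1) (by simp) using 1; ring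
    · left
      convert add_div_four_mem_leftBoundary hy (a := 2) (by simp) using 1; ring
    · right
      convert add_div_four_mem_leftBoundary hy (a := 1) (by simp) using 1; ring
  | succ n ih =>
    intro x hx
    obtain ⟨a, ha, y, hy, rfl⟩ := exists_digit_of_mem_leftBoundary hx
    have hpow : (1 : ℝ) / 4 ^ (n + 1 + 1) = 1 / 4 ^ (n + 1) / 4 := by
      rw [pow_succ _ (n + 1)]; field_simp
    rw [hpow]
    refine (ih y hy).imp (fun h => ?_) fun h => ?_
    · convert add_div_four_mem_leftBoundary h ha using 1; ring
    · convert add_div_four_mem_leftBoundary h ha using 1; ring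

theorem one_div_four_pow_mem_centerOfDistances (n : ℕ) :
    (1 / 4 ^ n : ℝ) ∈ centerOfDistances (cantorvalBoundary : Set ℝ) := by
  rw [mem_centerOfDistances_cantorvalBoundary_iff (by positivity)]
  intro x hx
  rcases n with _ | n
  · rw [pow_zero, div_one]
    exact (mem_cantorvalBoundary_cases hx).imp add_one_mem_cantorvalBoundary fun h => h.1
  · rcases mem_cantorvalBoundary_cases hx with h | h
    · exact (add_or_sub_mem_leftBoundary n x h).imp (fun h => h.1) fun h => h.1
    · refine (add_or_sub_mem_leftBoundary n _ h).imp (fun h => ?_) fun h => ?_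
      · convert add_one_mem_cantorvalBoundary h using 1; ring
      · convert add_one_mem_cantorvalBoundary h using 1; ring

/-- Isolating the leading digit of a positive element of the left boundary. -/
theorem exists_leading_digit {x : ℝ} (hx : x ∈ leftBoundary) (hpos : 0 < x) :
    ∃ (k : ℕ) (a t : ℝ), (a = 1 ∨ a = 2) ∧ t ∈ leftBoundary ∧ x = (a + t) / 4 / 4 ^ k := by
  obtain ⟨n, hn⟩ := exists_pow_lt_of_lt_one hpos (show (1 / 4 : ℝ) < 1 by norm_num)
  induction n generalizing x with
  | zero =>
    have := hx.2.2
    rw [pow_zero] at hn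
    linarith
  | succ n ih =>
    obtain ⟨a, ha, t, ht, rfl⟩ := exists_digit_of_mem_leftBoundary hx
    rcases ha with rfl | ha
    · rw [pow_succ] at hn
      obtain ⟨k, b, s, hb, hs, h⟩ := ih ht (by linarith) (by linarith)
      refine ⟨k + 1, b, s, hb, hs, ?_⟩
      rw [h, pow_succ]; field_simp; ring
    · exact ⟨0, a, t, ha, ht, by simp⟩

/-- A witness `x` at scale `4 ^ k` against a candidate distance with leading digit at that scale:
`x + α` falls into a gap, and `x - α` falls into a gap or is negative. -/
theorem notMem_centerOfDistances_of_witness {β x : ℝ} (k : ℕ) (hβ : 0 ≤ β)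
    (hx : x ∈ leftBoundary) (hadd : x + β ∈ Ioo (2 / 3 : ℝ) 1)
    (hsub : x - β < 0 ∨ x - β ∈ Ioo (1 / 6 : ℝ) (1 / 4)) :
    β / 4 ^ k ∉ centerOfDistances (cantorvalBoundary : Set ℝ) := by
  rw [mem_centerOfDistances_cantorvalBoundary_iff (by positivity)]
  intro h
  rcases h _ (div_four_pow_mem_leftBoundary hx k).1 with h | h
  · rw [← add_div] at h
    exact div_four_pow_notMem_cantorvalBoundary hadd k h
  · rw [← sub_div] at h
    rcases hsub with hs | ⟨hs₁, hs₂⟩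
    · exact div_four_pow_notMem_cantorvalBoundary_of_neg hs k h
    -- The gap `(1/6, 1/4)` is `(2/3, 1)` shrunk by 4, hence the exponent `k + 1`.
    · refine div_four_pow_notMem_cantorvalBoundary (z := 4 * (x - β))
        ⟨by linarith, by linarith⟩ (k + 1) ?_
      convert h using 1
      rw [pow_succ]; field_simp

theorem eq_one_div_four_pow_of_mem_leftBoundary {α : ℝ} (hα : α ∈ leftBoundary) (hpos : 0 < α)
    (hc : α ∈ centerOfDistances (cantorvalBoundary : Set ℝ)) : ∃ n : ℕ, α = 1 / 4 ^ n := by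
  obtain ⟨k, a, t, ha, ht, rfl⟩ := exists_leading_digit hα hpos
  have ht₀ := ht.2.1
  have ht₁ := ht.2.2
  have hzero := zero_mem_leftBoundary
  have h₁ : (1 + 0) / 4 ∈ leftBoundary := add_div_four_mem_leftBoundary hzero (by simp)
  have h₂ : (2 + 0) / 4 ∈ leftBoundary := add_div_four_mem_leftBoundary hzero (by simp)
  have h₁₁ : (1 + (1 + 0) / 4) / 4 ∈ leftBoundary := add_div_four_mem_leftBoundary h₁ (by simp)
  have h₂₁ : (2 + (1 + 0) / 4) / 4 ∈ leftBoundary := add_div_four_mem_leftBoundary h₁ (by simp)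
  rcases ha with rfl | rfl
  · rcases ht₀.eq_or_lt with rfl | htpos
    · exact ⟨k + 1, by rw [pow_succ]; field_simp; ring⟩
    · exfalso
      -- With `β = (1 + t) / 4`, the witness `1/2` has `x - β > 1/6` iff `t < 1/3`, and `5/16` has
      -- `x + β > 2/3` iff `t > 5/12`; `9/16` covers the range between.
      rcases lt_or_ge t (1 / 3) with h | h
      · exact notMem_centerOfDistances_of_witness k (by linarith) h₂
          ⟨by linarith, by linarith⟩ (Or.inr ⟨by linarith, by linarith⟩) hc
      · rcases le_or_gt t (5 / 12) with h' | h'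
        · exact notMem_centerOfDistances_of_witness k (by linarith) h₂₁
            ⟨by linarith, by linarith⟩ (Or.inr ⟨by linarith, by linarith⟩) hc
        · exact notMem_centerOfDistances_of_witness k (by linarith) h₁₁
            ⟨by linarith, by linarith⟩ (Or.inl (by linarith)) hc
  · exact absurd hc (notMem_centerOfDistances_of_witness k (by linarith) h₁
      ⟨by linarith, by linarith⟩ (Or.inl (by linarith)))

theorem theorem13 :
    centerOfDistances (cantorvalBoundary : Set ℝ) =
      ({0} : Set ℝ) ∪ {α : ℝ | ∃ n : ℕ, α = 1 / 4 ^ n} := by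
  refine Subset.antisymm (fun α hα => ?_) ?_
  · obtain ⟨y, hy⟩ := hα ⟨0, zero_mem_cantorvalBoundary⟩
    have hnonneg : 0 ≤ α := hy ▸ dist_nonneg
    have hmem : α ∈ cantorvalBoundary := by
      rw [Subtype.dist_eq, Real.dist_eq, zero_sub, abs_neg,
        abs_of_nonneg (cantorvalBoundary_nonneg y.2)] at hy
      exact hy ▸ y.2
    rcases hnonneg.eq_or_lt with rfl | hpos
    · exact Or.inl rfl
    right
    rcases mem_cantorvalBoundary_cases hmem with h | h
    · exact eq_one_div_four_pow_of_mem_leftBoundary h hpos hα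
    · rcases h.2.1.eq_or_lt with h₀ | h₀
      · exact ⟨0, by rw [pow_zero]; linarith⟩
      · exfalso
        rw [mem_centerOfDistances_cantorvalBoundary_iff hnonneg] at hα
        -- Here `α > 1`, so `1 + α` exceeds `5/3` and `1 - α` is negative.
        have h1 : (1 : ℝ) ∈ cantorvalBoundary := by
          simpa using add_one_mem_cantorvalBoundary zero_mem_leftBoundary
        rcases hα 1 h1 with h' | h'
        · linarith [cantorvalBoundary_le h']
        · linarith [cantorvalBoundary_nonneg h']
  · rintro α (rfl | ⟨n, rfl⟩)
    · exact fun x => ⟨x, dist_self x⟩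
    · exact one_div_four_pow_mem_centerOfDistances n
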